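/- Let $d\in\mathbb N$ and let $\Omega\subset\mathbb{R}^d$ be a bounded open set with Lipschitz boundary: for every $x_0\in\partial\Omega$ there are an orthonormal coordinate system $x=(x',x_d)\in\mathbb R^{d-1}\times\mathbb R$, a Lipschitz function $f:\mathbb{R}^{d-1}\to\mathbb{R}$ and $r>0$ such that, in these coordinates, $\Omega\cap B(x_0,r)=\{x\in B(x_0,r): x_d>f(x')\}$. Let $X,Y$ be Banach spaces such that $Y$ is compactly embedded in $X$, i.e. there is an injective compact linear operator $\iota:Y\to X$, through which $Y$ is regarded as a subspace of $X$ and $L^p(\Omega,Y)$ as a subspace of $L^p(\Omega,X)$. Let $1\le p<\infty$. Let $W^{1,p}(\Omega,X)$ be the space of all $u\in L^p(\Omega,X)$ for which there are $D_1u,\dots,D_du\in L^p(\Omega,X)$ with $\int_\Omega u\,\partial_j\varphi=-\int_\Omega D_ju\,\varphi$ for all $\varphi\in C_c^\infty(\Omega,\mathbb{R})$ and $j=1,\dots,d$, with the norm $\|u\|_{W^{1,p}(\Omega,X)}=\|u\|_{L^p(\Omega,X)}+\sum_{j}\|D_ju\|_{L^p(\Omega,X)}$. Equip $W^{1,p}(\Omega,X)\cap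 L^p(\Omega,Y)$ with the norm $\|u\|_{W^{1,p}(\Omega,X)}+\|u\|_{L^p(\Omega,Y)}$. Then the embedding $$W^{1,p}(\Omega,X)\cap L^p(\Omega,Y)\hookrightarrow L^p(\Omega,X)$$ is compact. -/

import Mathlib

open MeasureTheory TopologicalSpace
open scoped ENNReal NNReal Distributions

/-- `Ω` has Lipschitz boundary: near each boundary point, in suitable orthonormal coordinates
(`ν` being the last coordinate direction and `νᗮ` the hyperplane of the remaining coordinates),
`Ω` is the part of a ball lying strictly above the graph of a Lipschitz function. -/
def HasLipschitzBoundary {d : ℕ} (Ω : Set (EuclideanSpace ℝ (Fin d))) : Prop :=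
  ∀ x₀ ∈ frontier Ω, ∃ (ν : EuclideanSpace ℝ (Fin d)) (f : (ℝ ∙ ν)ᗮ → ℝ) (L : ℝ≥0) (r : ℝ),
    ‖ν‖ = 1 ∧ LipschitzWith L f ∧ 0 < r ∧
      ∀ x ∈ Metric.ball x₀ r,
        x ∈ Ω ↔ f ((ℝ ∙ ν)ᗮ.orthogonalProjectionOnto x) < inner ℝ ν x

section Sobolev

variable {d : ℕ} {Ω : Opens (EuclideanSpace ℝ (Fin d))} {p : ℝ≥0∞}
  {X : Type*} [NormedAddCommGroup X] [NormedSpace ℝ X]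

/-- The Bochner space `L^p(Ω, X)` with respect to Lebesgue measure on `Ω`. -/
abbrev BochnerLp {d : ℕ} (Ω : Opens (EuclideanSpace ℝ (Fin d))) (p : ℝ≥0∞)
    (X : Type*) [NormedAddCommGroup X] : Type _ :=
  Lp X p (volume.restrict (Ω : Set (EuclideanSpace ℝ (Fin d))))

/-- The classical partial derivative `∂_j φ`. -/
noncomputable def partialDeriv {d : ℕ} (j : Fin d) (φ : EuclideanSpace ℝ (Fin d) → ℝ)
    (x : EuclideanSpace ℝ (Fin d)) : ℝ :=
  fderiv ℝ φ x (EuclideanSpace.single j 1)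

/-- `g` is a distributional derivative of `u` on `Ω` in direction `j`:
`∫_Ω u ∂_jφ = - ∫_Ω g φ` for all `φ ∈ C_c^∞(Ω, ℝ)`. -/
def HasDistribDeriv {d : ℕ} (Ω : Opens (EuclideanSpace ℝ (Fin d)))
    {X : Type*} [NormedAddCommGroup X] [NormedSpace ℝ X] (j : Fin d)
    (u g : EuclideanSpace ℝ (Fin d) → X) : Prop :=
  ∀ φ : 𝓓(Ω, ℝ),
    ∫ x in Ω, partialDeriv j φ x • u x = - ∫ x in Ω, φ x • g x

theorem integrable_testFunction_smul (hp : 1 ≤ p) (φ : 𝓓(Ω, ℝ)) (u : BochnerLp Ω p X) :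
    Integrable (fun x ↦ φ x • u x) (volume.restrict (Ω : Set (EuclideanSpace ℝ (Fin d)))) :=
  ((Lp.memLp u).locallyIntegrable hp).integrable_smul_left_of_hasCompactSupport
    φ.continuous φ.hasCompactSupport

theorem integrable_partialDeriv_smul (hp : 1 ≤ p) (j : Fin d) (φ : 𝓓(Ω, ℝ))
    (u : BochnerLp Ω p X) :
    Integrable (fun x ↦ partialDeriv j φ x • u x)
      (volume.restrict (Ω : Set (EuclideanSpace ℝ (Fin d)))) :=
  ((Lp.memLp u).locallyIntegrable hp).integrable_smul_left_of_hasCompactSupport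
    ((φ.contDiff.continuous_fderiv (by simp)).clm_apply continuous_const)
    (φ.hasCompactSupport.fderiv_apply ℝ _)

theorem HasDistribDeriv.add (hp : 1 ≤ p) {j : Fin d} {u v g h : BochnerLp Ω p X}
    (hu : HasDistribDeriv Ω j u g) (hv : HasDistribDeriv Ω j v h) :
    HasDistribDeriv Ω j ⇑(u + v) ⇑(g + h) := by
  intro φ
  have e₁ : ∫ x in Ω, partialDeriv j φ x • (u + v) x =
      ∫ x in Ω, (partialDeriv j φ x • u x + partialDeriv j φ x • v x) := by
    refine integral_congr_ae ?_
    filter_upwards [Lp.coeFn_add u v] with x hx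
    rw [hx, Pi.add_apply, smul_add]
  have e₂ : ∫ x in Ω, φ x • (g + h) x = ∫ x in Ω, (φ x • g x + φ x • h x) := by
    refine integral_congr_ae ?_
    filter_upwards [Lp.coeFn_add g h] with x hx
    rw [hx, Pi.add_apply, smul_add]
  rw [e₁, e₂, integral_add (integrable_partialDeriv_smul hp j φ u)
    (integrable_partialDeriv_smul hp j φ v), integral_add (integrable_testFunction_smul hp φ g)
    (integrable_testFunction_smul hp φ h), hu φ, hv φ, neg_add]

theorem HasDistribDeriv.smul {j : Fin d} (c : ℝ) {u g : BochnerLp Ω p X}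
    (hu : HasDistribDeriv Ω j u g) : HasDistribDeriv Ω j ⇑(c • u) ⇑(c • g) := by
  intro φ
  have e₁ : ∫ x in Ω, partialDeriv j φ x • (c • u) x =
      ∫ x in Ω, c • (partialDeriv j φ x • u x) := by
    refine integral_congr_ae ?_
    filter_upwards [Lp.coeFn_smul c u] with x hx
    rw [hx, Pi.smul_apply, smul_comm]
  have e₂ : ∫ x in Ω, φ x • (c • g) x = ∫ x in Ω, c • (φ x • g x) := by
    refine integral_congr_ae ?_
    filter_upwards [Lp.coeFn_smul c g] with x hx
    rw [hx, Pi.smul_apply, smul_comm]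
  rw [e₁, e₂, integral_smul, integral_smul, hu φ, smul_neg]

theorem HasDistribDeriv.zero {j : Fin d} :
    HasDistribDeriv Ω j ⇑(0 : BochnerLp Ω p X) ⇑(0 : BochnerLp Ω p X) := by
  have h := Lp.coeFn_zero X p (volume.restrict (Ω : Set (EuclideanSpace ℝ (Fin d))))
  intro φ
  have e₁ : ∫ x in Ω, partialDeriv j φ x • (0 : BochnerLp Ω p X) x = 0 := by
    refine integral_eq_zero_of_ae ?_
    filter_upwards [h] with x hx
    rw [hx, Pi.zero_apply, smul_zero]
  have e₂ : ∫ x in Ω, φ x • (0 : BochnerLp Ω p X) x = 0 := by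
    refine integral_eq_zero_of_ae ?_
    filter_upwards [h] with x hx
    rw [hx, Pi.zero_apply, smul_zero]
  rw [e₁, e₂, neg_zero]

/-- The distributional derivative is unique. -/
theorem HasDistribDeriv.unique [CompleteSpace X] (hp : 1 ≤ p) {j : Fin d}
    {u g h : BochnerLp Ω p X}
    (hg : HasDistribDeriv Ω j u g) (hh : HasDistribDeriv Ω j u h) : g = h := by
  have key := Ω.isOpen.ae_eq_zero_of_integral_contDiff_smul_eq_zero
    (μ := volume.restrict (Ω : Set (EuclideanSpace ℝ (Fin d)))) (f := fun x ↦ g x - h x)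
    ((((Lp.memLp g).locallyIntegrable hp).sub ((Lp.memLp h).locallyIntegrable hp)).locallyIntegrableOn
      _) (fun φ h₁ h₂ h₃ ↦ by
        let ψ : 𝓓(Ω, ℝ) := ⟨φ, h₁, h₂, h₃⟩
        have e := (hg ψ).symm.trans (hh ψ)
        have e' : ∫ x in Ω, ψ x • g x = ∫ x in Ω, ψ x • h x := neg_injective e
        have e'' : ∫ x in Ω, ψ x • (g x - h x) = 0 := by
          simp only [smul_sub]
          rw [integral_sub (integrable_testFunction_smul hp ψ g)
            (integrable_testFunction_smul hp ψ h), e', sub_self]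
        exact e'')
  refine Lp.ext ?_
  filter_upwards [key, ae_restrict_mem Ω.isOpen.measurableSet] with x hx hx'
  exact sub_eq_zero.mp (hx hx')

/-- The first Sobolev space `W^{1,p}(Ω, X)`, as a subspace of `L^p(Ω, X)`. -/
def sobolevSubmodule {d : ℕ} (Ω : Opens (EuclideanSpace ℝ (Fin d))) (p : ℝ≥0∞)
    [hp : Fact (1 ≤ p)] (X : Type*) [NormedAddCommGroup X] [NormedSpace ℝ X] :
    Submodule ℝ (BochnerLp Ω p X) where
  carrier := {u | ∀ j : Fin d, ∃ g : BochnerLp Ω p X, HasDistribDeriv Ω j u g}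
  add_mem' hu hv j :=
    let ⟨g, hg⟩ := hu j
    let ⟨h, hh⟩ := hv j
    ⟨g + h, hg.add hp.out hh⟩
  zero_mem' _ := ⟨0, HasDistribDeriv.zero⟩
  smul_mem' c _ hu j :=
    let ⟨g, hg⟩ := hu j
    ⟨c • g, hg.smul c⟩

variable [hp : Fact (1 ≤ p)] {Y : Type*} [NormedAddCommGroup Y] [NormedSpace ℝ Y]

theorem compLpL_injective {ι : Y →L[ℝ] X} (hι : Function.Injective ι) :
    Function.Injective
      (ι.compLpL p (volume.restrict (Ω : Set (EuclideanSpace ℝ (Fin d))))) := by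
  intro v w h
  refine Lp.ext ?_
  filter_upwards [ι.coeFn_compLpL v, ι.coeFn_compLpL w] with x hv hw
  rw [h] at hv
  exact hι (hv.symm.trans hw)

variable [CompleteSpace X]

/-- The distributional derivative `D_j : W^{1,p}(Ω, X) → L^p(Ω, X)`. -/
noncomputable def distribDeriv (j : Fin d) : sobolevSubmodule Ω p X →ₗ[ℝ] BochnerLp Ω p X where
  toFun u := (u.2 j).choose
  map_add' u v := (((u + v).2 j).choose_spec).unique hp.out
    ((u.2 j).choose_spec.add hp.out (v.2 j).choose_spec)
  map_smul' c u := (((c • u).2 j).choose_spec).unique hp.out ((u.2 j).choose_spec.smul c)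

theorem hasDistribDeriv_distribDeriv (j : Fin d) (u : sobolevSubmodule Ω p X) :
    HasDistribDeriv Ω j ⇑(u : BochnerLp Ω p X) ⇑(distribDeriv j u) :=
  (u.2 j).choose_spec

/-- The norm `‖u‖_{L^p(Ω, X)} + ∑_j ‖D_j u‖_{L^p(Ω, X)}` of `W^{1,p}(Ω, X)`. -/
noncomputable def sobolevNorm (u : sobolevSubmodule Ω p X) : ℝ :=
  ‖(u : BochnerLp Ω p X)‖ + ∑ j, ‖distribDeriv j u‖

/-- `W^{1,p}(Ω, X) ∩ L^p(Ω, Y)`, where `Y` is a subspace of `X` through the injection `ι`, so that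
`L^p(Ω, Y)` is identified with the classes of the functions `ι ∘ v`, `v ∈ L^p(Ω, Y)`. It is a type
of its own because it carries its own norm, not the one of `L^p(Ω, X)`. -/
def SobolevInterLp {d : ℕ} (Ω : Opens (EuclideanSpace ℝ (Fin d))) (p : ℝ≥0∞) [Fact (1 ≤ p)]
    {X Y : Type*} [NormedAddCommGroup X] [NormedSpace ℝ X]
    [NormedAddCommGroup Y] [NormedSpace ℝ Y] (ι : Y →L[ℝ] X) (_hι : Function.Injective ι) :
    Type _ :=
  ↥(sobolevSubmodule Ω p X ⊓
    (ι.compLpL p (volume.restrict (Ω : Set (EuclideanSpace ℝ (Fin d))))).range)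

namespace SobolevInterLp

variable {ι : Y →L[ℝ] X} {hι : Function.Injective ι}

set_option linter.unusedSectionVars false

noncomputable instance : AddCommGroup (SobolevInterLp Ω p ι hι) :=
  inferInstanceAs (AddCommGroup ↥(sobolevSubmodule Ω p X ⊓
    (ι.compLpL p (volume.restrict (Ω : Set (EuclideanSpace ℝ (Fin d))))).range))

noncomputable instance : Module ℝ (SobolevInterLp Ω p ι hι) :=
  inferInstanceAs (Module ℝ ↥(sobolevSubmodule Ω p X ⊓
    (ι.compLpL p (volume.restrict (Ω : Set (EuclideanSpace ℝ (Fin d))))).range))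

/-- The element `u` as an element of `W^{1,p}(Ω, X)`. -/
noncomputable def toSobolev : SobolevInterLp Ω p ι hι →ₗ[ℝ] sobolevSubmodule Ω p X :=
  Submodule.inclusion inf_le_left

/-- The element `u` as an element of `L^p(Ω, X)`. -/
noncomputable def toLp : SobolevInterLp Ω p ι hι →ₗ[ℝ] BochnerLp Ω p X :=
  (sobolevSubmodule Ω p X).subtype ∘ₗ toSobolev

/-- The element `u` as an element of `L^p(Ω, Y)`. -/
noncomputable def toLpY : SobolevInterLp Ω p ι hι →ₗ[ℝ] BochnerLp Ω p Y :=
  (LinearEquiv.ofInjective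
    (ι.compLpL p (volume.restrict (Ω : Set (EuclideanSpace ℝ (Fin d))))).toLinearMap
    (compLpL_injective hι)).symm.toLinearMap ∘ₗ Submodule.inclusion inf_le_right

theorem toLp_injective :
    Function.Injective (toLp : SobolevInterLp Ω p ι hι →ₗ[ℝ] BochnerLp Ω p X) :=
  fun _ _ h ↦ Subtype.ext h

theorem compLpL_toLpY (u : SobolevInterLp Ω p ι hι) :
    ι.compLpL p (volume.restrict (Ω : Set (EuclideanSpace ℝ (Fin d)))) (toLpY u) = toLp u :=
  congrArg Subtype.val (LinearEquiv.apply_symm_apply (LinearEquiv.ofInjective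
    (ι.compLpL p (volume.restrict (Ω : Set (EuclideanSpace ℝ (Fin d))))).toLinearMap
    (compLpL_injective hι)) (Submodule.inclusion inf_le_right u))

/-- The norm of `W^{1,p}(Ω, X) ∩ L^p(Ω, Y)`:
`‖u‖ = ‖u‖_{W^{1,p}(Ω, X)} + ‖u‖_{L^p(Ω, Y)}`. -/
noncomputable instance : Norm (SobolevInterLp Ω p ι hι) :=
  ⟨fun u ↦ sobolevNorm (toSobolev u) + ‖toLpY u‖⟩

theorem norm_def (u : SobolevInterLp Ω p ι hι) :
    ‖u‖ = ‖toLp u‖ + ∑ j, ‖distribDeriv j (toSobolev u)‖ + ‖toLpY u‖ := rfl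

theorem norm_toLp_le (u : SobolevInterLp Ω p ι hι) : ‖toLp u‖ ≤ ‖u‖ := by
  have h : 0 ≤ ∑ j, ‖distribDeriv j (toSobolev u)‖ := Finset.sum_nonneg fun _ _ ↦ norm_nonneg _
  have h' := norm_nonneg (toLpY u)
  rw [norm_def]
  linarith

theorem normedSpaceCore : NormedSpace.Core ℝ (SobolevInterLp Ω p ι hι) where
  norm_nonneg u := (norm_nonneg _).trans (norm_toLp_le u)
  norm_smul c u := by
    simp only [norm_def, map_smul, norm_smul, ← Finset.mul_sum, mul_add]
  norm_triangle u v := by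
    have h : ∑ j, ‖distribDeriv j (toSobolev (u + v))‖ ≤
        ∑ j, ‖distribDeriv j (toSobolev u)‖ + ∑ j, ‖distribDeriv j (toSobolev v)‖ := by
      rw [← Finset.sum_add_distrib]
      refine Finset.sum_le_sum fun j _ ↦ ?_
      rw [map_add, map_add]
      exact norm_add_le _ _
    have h₁ := norm_add_le (toLp u) (toLp v)
    have h₂ := norm_add_le (toLpY u) (toLpY v)
    rw [← map_add] at h₁ h₂
    simp only [norm_def]
    linarith
  norm_eq_zero_iff u := by
    constructor
    · intro h
      apply toLp_injective
      rw [map_zero, ← norm_le_zero_iff, ← h]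
      exact norm_toLp_le u
    · rintro rfl
      simp [norm_def]

noncomputable instance : NormedAddCommGroup (SobolevInterLp Ω p ι hι) :=
  NormedAddCommGroup.ofCore normedSpaceCore

noncomputable instance : NormedSpace ℝ (SobolevInterLp Ω p ι hι) :=
  NormedSpace.ofCore normedSpaceCore

variable (Ω p ι hι) in
/-- The embedding `W^{1,p}(Ω, X) ∩ L^p(Ω, Y) ↪ L^p(Ω, X)`, `u ↦ u`. -/
noncomputable def embedding : SobolevInterLp Ω p ι hι →L[ℝ] BochnerLp Ω p X :=
  toLp.mkContinuous 1 fun u ↦ by simpa using norm_toLp_le u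

end SobolevInterLp

end Sobolev

/-! The proof uses neither an extension operator nor mollification: functions are only ever
translated into `Ω`. A Lipschitz boundary provides, near each point of the closure, a piece `U` of
`Ω` and arbitrarily small balls `B(w, s)` of vectors `z` with `x + t z ∈ Ω` for all `x ∈ U`, `0 ≤ t
≤ 1` (`HasLipschitzBoundary.exists_cone`). For such `z` the weak derivative can be integrated along
the segment, so the `L^p(U)` norm of `u(· + z) - u` is at most `‖z‖` times the Sobolev norm
(`lintegral_sub_translate_le`).

Hence `u(x)` is close in `L^p(U)` to averages of `u` over balls inside `x + B(w, s)`. Let the centre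
of that ball depend on `x` only through a nearby point `π x` of a finite net. The approximant is
then a step function, and the change of centre costs only a factor depending on the dimension
(`lintegral_sub_average_le`).

Each value of the step function is the average of some `ι ∘ v` over a fixed set, with `v` bounded in
`L^p(Ω, Y)`. It therefore lies in a fixed compact subset of `X`
(`SobolevInterLp.exists_isCompact_setAverage_mem`). So the unit ball, restricted to `U`, is within
every `ε` of a compact set and is totally bounded. Finitely many pieces `U` cover `Ω`. -/

/-! ### Fundamental theorem of calculus and translation estimate for weak derivatives. -/

theorem integral_fderiv_sub_smul_eq {E : Type*} [NormedAddCommGroup E] [NormedSpace ℝ E]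
    {φ : E → ℝ} (hφ : ContDiff ℝ 1 φ) (y z : E) :
    ∫ t in Set.Ioc (0 : ℝ) 1, fderiv ℝ φ (y - t • z) z = φ y - φ (y - z) := by
  have hd : ∀ t : ℝ, HasDerivAt (fun t : ℝ ↦ - φ (y - t • z)) (fderiv ℝ φ (y - t • z) z) t := by
    intro t
    have h1 : HasDerivAt (fun t : ℝ ↦ y - t • z) (-z) t := by
      simpa using ((hasDerivAt_id t).smul_const z).const_sub y
    have h2 := ((hφ.differentiable one_ne_zero) (y - t • z)).hasFDerivAt.comp_hasDerivAt t h1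
    have h3 := h2.neg
    rw [map_neg, neg_neg] at h3
    exact h3
  have hc : Continuous fun t : ℝ ↦ fderiv ℝ φ (y - t • z) z :=
    ((hφ.continuous_fderiv one_ne_zero).comp (by fun_prop)).clm_apply continuous_const
  rw [← intervalIntegral.integral_of_le zero_le_one,
    intervalIntegral.integral_eq_sub_of_hasDerivAt (fun t _ ↦ hd t) (hc.intervalIntegrable _ _)]
  simp
  ring

section Shear

variable {E : Type*} [NormedAddCommGroup E] [NormedSpace ℝ E] [MeasurableSpace E] [BorelSpace E]
  [FiniteDimensional ℝ E] (μ : Measure E) [μ.IsAddHaarMeasure]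

/-- Each slice is a translation, which preserves Haar measure. This makes `g (x + t z)` jointly
measurable and integrable in `(t, x)`, as the Fubini arguments require. -/
theorem measurePreserving_shear (ν : Measure ℝ) [SFinite ν] (z : E) :
    MeasurePreserving (fun q : ℝ × E ↦ (q.1, q.2 + q.1 • z)) (ν.prod μ) (ν.prod μ) := by
  refine (MeasurePreserving.id ν).skew_product (g := fun t x ↦ x + t • z) ?_ ?_
  · exact (by fun_prop : Continuous fun q : ℝ × E ↦ q.2 + q.1 • z).measurable
  · exact Filter.Eventually.of_forall fun t ↦ map_add_right_eq_self μ (t • z)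

variable {X : Type*} [NormedAddCommGroup X]

theorem integrable_comp_shear {g : E → X} (hg : Integrable g μ) (z : E) :
    Integrable (fun q : ℝ × E ↦ g (q.2 + q.1 • z))
      ((volume.restrict (Set.Ioc (0 : ℝ) 1)).prod μ) :=
  (measurePreserving_shear μ _ z).integrable_comp_of_integrable (hg.comp_snd _)

/-- A function whose weak derivative in the direction `z` is `g` along the translates
`U + t z`, `0 ≤ t ≤ 1`, satisfies the fundamental theorem of calculus almost everywhere in `U`. -/
theorem ae_sub_eq_integral_of_weak_deriv [NormedSpace ℝ X] [CompleteSpace X] {u g : E → X}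
    (hu : Integrable u μ)
    (hg : Integrable g μ) {U : Set E} (hU : IsOpen U) (z : E)
    (h : ∀ t ∈ Set.Icc (0 : ℝ) 1, ∀ φ : E → ℝ, ContDiff ℝ (↑(⊤ : ℕ∞)) φ → HasCompactSupport φ →
      tsupport φ ⊆ U → ∫ y, fderiv ℝ φ (y - t • z) z • u y ∂μ = - ∫ y, φ (y - t • z) • g y ∂μ) :
    ∀ᵐ x ∂μ, x ∈ U → u (x + z) - u x = ∫ t in Set.Ioc (0 : ℝ) 1, g (x + t • z) := by
  have hw : Integrable (fun x ↦ ∫ t in Set.Ioc (0 : ℝ) 1, g (x + t • z)) μ :=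
    (integrable_comp_shear μ hg z).integral_prod_right
  have huz : Integrable (fun x ↦ u (x + z)) μ := hu.comp_add_right z
  have key := hU.ae_eq_zero_of_integral_contDiff_smul_eq_zero (μ := μ)
    (f := fun x ↦ (u (x + z) - u x) - ∫ t in Set.Ioc (0 : ℝ) 1, g (x + t • z))
    (Integrable.locallyIntegrable ((huz.sub hu).sub hw) |>.locallyIntegrableOn U) ?_
  · filter_upwards [key] with x hx hxU
    exact sub_eq_zero.mp (hx hxU)
  -- Test against `φ`. By Fubini and a translation, the integral of `g` becomes a `t`-average of
  -- integrals against `φ (· - t z)`. The hypothesis moves the derivative onto `φ`, and the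
  -- classical theorem in `t` leaves `φ y - φ (y - z)` against `u`.
  intro φ hφ hφc hφU
  obtain ⟨C, hC⟩ := hφc.exists_bound_of_continuous hφ.continuous
  have hφ1 : ContDiff ℝ 1 φ := hφ.of_le (by simp)
  have hdφ : Continuous fun y ↦ fderiv ℝ φ y z :=
    (hφ1.continuous_fderiv one_ne_zero).clm_apply continuous_const
  obtain ⟨D, hD⟩ := (hφc.fderiv_apply ℝ z).exists_bound_of_continuous hdφ
  have hmul : ∀ {v : E → X}, Integrable v μ → Integrable (fun x ↦ φ x • v x) μ := fun hv ↦
    hv.bdd_smul C hφ.continuous.aestronglyMeasurable (Filter.Eventually.of_forall hC)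
  have e1 : ∫ x, φ x • (∫ t in Set.Ioc (0 : ℝ) 1, g (x + t • z)) ∂μ =
      ∫ t in Set.Ioc (0 : ℝ) 1, ∫ y, φ (y - t • z) • g y ∂μ := by
    have hi : Integrable (fun q : ℝ × E ↦ φ q.2 • g (q.2 + q.1 • z))
        ((volume.restrict (Set.Ioc (0 : ℝ) 1)).prod μ) :=
      (integrable_comp_shear μ hg z).bdd_smul C
        (hφ.continuous.comp continuous_snd).aestronglyMeasurable
        (Filter.Eventually.of_forall fun q ↦ hC q.2)
    simp_rw [← integral_smul]
    rw [← integral_integral_swap hi]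
    refine integral_congr_ae (Filter.Eventually.of_forall fun t ↦ ?_)
    have := integral_add_right_eq_self (μ := μ) (fun y ↦ φ (y - t • z) • g y) (t • z)
    simpa using this
  have e2 : ∫ t in Set.Ioc (0 : ℝ) 1, ∫ y, fderiv ℝ φ (y - t • z) z • u y ∂μ =
      ∫ y, (φ y - φ (y - z)) • u y ∂μ := by
    have hi : Integrable (fun q : ℝ × E ↦ fderiv ℝ φ (q.2 - q.1 • z) z • u q.2)
        ((volume.restrict (Set.Ioc (0 : ℝ) 1)).prod μ) :=
      (hu.comp_snd _).bdd_smul D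
        (hdφ.comp (by fun_prop : Continuous fun q : ℝ × E ↦ q.2 - q.1 • z)).aestronglyMeasurable
        (Filter.Eventually.of_forall fun q ↦ hD _)
    rw [integral_integral_swap hi]
    refine integral_congr_ae (Filter.Eventually.of_forall fun y ↦ ?_)
    simp only
    rw [integral_smul_const, integral_fderiv_sub_smul_eq hφ1]
  have e3 : ∫ x, φ x • u (x + z) ∂μ = ∫ y, φ (y - z) • u y ∂μ := by
    have := integral_add_right_eq_self (μ := μ) (fun y ↦ φ (y - z) • u y) z
    simpa using this
  have hi3 : Integrable (fun y ↦ φ (y - z) • u y) μ :=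
    hu.bdd_smul C (hφ.continuous.comp (by fun_prop)).aestronglyMeasurable
      (Filter.Eventually.of_forall fun x ↦ hC _)
  have e4 : ∫ t in Set.Ioc (0 : ℝ) 1, ∫ y, fderiv ℝ φ (y - t • z) z • u y ∂μ =
      - ∫ t in Set.Ioc (0 : ℝ) 1, ∫ y, φ (y - t • z) • g y ∂μ := by
    rw [← integral_neg]
    refine setIntegral_congr_fun measurableSet_Ioc fun t ht ↦ ?_
    exact h t ⟨ht.1.le, ht.2⟩ φ hφ hφc hφU
  have e5 : ∫ y, (φ y - φ (y - z)) • u y ∂μ =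
      ∫ y, φ y • u y ∂μ - ∫ y, φ (y - z) • u y ∂μ := by
    simp_rw [sub_smul]
    exact integral_sub (hmul hu) hi3
  have hi6 : Integrable (fun x ↦ φ x • u (x + z) - φ x • u x) μ := (hmul huz).sub (hmul hu)
  simp_rw [smul_sub]
  rw [integral_sub hi6 (hmul hw), integral_sub (hmul huz) (hmul hu), e1, e3,
    ← neg_neg (∫ t in Set.Ioc (0 : ℝ) 1, ∫ y, φ (y - t • z) • g y ∂μ), ← e4, e2, e5]
  abel

end Shear

/-- Jensen's inequality for `r ↦ r ^ q`, obtained from the monotonicity of `L^q` norms on a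
probability space. -/
theorem rpow_enorm_integral_le {α X : Type*} {mα : MeasurableSpace α} [NormedAddCommGroup X]
    [NormedSpace ℝ X] {μ : Measure α} [IsProbabilityMeasure μ] {f : α → X}
    (hf : AEStronglyMeasurable f μ) {q : ℝ} (hq : 1 ≤ q) :
    ‖∫ x, f x ∂μ‖ₑ ^ q ≤ ∫⁻ x, ‖f x‖ₑ ^ q ∂μ := by
  have h := eLpNorm'_le_eLpNorm'_of_exponent_le zero_lt_one hq μ hf
  have h0 : 0 < q := by linarith
  simp only [eLpNorm', ENNReal.rpow_one, div_one] at h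
  calc ‖∫ x, f x ∂μ‖ₑ ^ q ≤ ((∫⁻ x, ‖f x‖ₑ ^ q ∂μ) ^ (1 / q)) ^ q := by
        gcongr
        exact (enorm_integral_le_lintegral_enorm f).trans h
    _ = _ := by rw [← ENNReal.rpow_mul, one_div_mul_cancel h0.ne', ENNReal.rpow_one]

/-- The translation estimate for functions with an integrable weak derivative. -/
theorem lintegral_sub_translate_le_of_weak_deriv {E : Type*} [NormedAddCommGroup E]
    [NormedSpace ℝ E] [MeasurableSpace E] [BorelSpace E] [FiniteDimensional ℝ E] (μ : Measure E)
    [μ.IsAddHaarMeasure] {X : Type*} [NormedAddCommGroup X] [NormedSpace ℝ X] [CompleteSpace X]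
    {u g : E → X} (hu : Integrable u μ) (hg : Integrable g μ) {U : Set E} (hU : IsOpen U) (z : E)
    (h : ∀ t ∈ Set.Icc (0 : ℝ) 1, ∀ φ : E → ℝ, ContDiff ℝ (↑(⊤ : ℕ∞)) φ → HasCompactSupport φ →
      tsupport φ ⊆ U → ∫ y, fderiv ℝ φ (y - t • z) z • u y ∂μ = - ∫ y, φ (y - t • z) • g y ∂μ)
    {q : ℝ} (hq : 1 ≤ q) :
    ∫⁻ x in U, ‖u (x + z) - u x‖ₑ ^ q ∂μ ≤ ∫⁻ x, ‖g x‖ₑ ^ q ∂μ := by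
  have : IsProbabilityMeasure (volume.restrict (Set.Ioc (0 : ℝ) 1)) := ⟨by simp⟩
  have hs := (integrable_comp_shear μ hg z)
  have hgm : AEMeasurable (fun q' : ℝ × E ↦ ‖g (q'.2 + q'.1 • z)‖ₑ ^ q)
      ((volume.restrict (Set.Ioc (0 : ℝ) 1)).prod μ) := hs.1.enorm.pow_const q
  have hsec : ∀ᵐ x ∂μ, AEStronglyMeasurable (fun t : ℝ ↦ g (x + t • z))
      (volume.restrict (Set.Ioc (0 : ℝ) 1)) := hs.1.prodMk_right
  calc ∫⁻ x in U, ‖u (x + z) - u x‖ₑ ^ q ∂μ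
      ≤ ∫⁻ x in U, (∫⁻ t in Set.Ioc (0 : ℝ) 1, ‖g (x + t • z)‖ₑ ^ q) ∂μ := by
        refine setLIntegral_mono_ae' hU.measurableSet ?_
        filter_upwards [ae_sub_eq_integral_of_weak_deriv μ hu hg hU z h, hsec] with x hx hx' hxU
        rw [hx hxU]
        exact rpow_enorm_integral_le hx' hq
    _ ≤ ∫⁻ x, (∫⁻ t in Set.Ioc (0 : ℝ) 1, ‖g (x + t • z)‖ₑ ^ q) ∂μ := setLIntegral_le_lintegral _ _
    _ = ∫⁻ t in Set.Ioc (0 : ℝ) 1, ∫⁻ x, ‖g (x + t • z)‖ₑ ^ q ∂μ :=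
        (lintegral_lintegral_swap (f := fun t x ↦ ‖g (x + t • z)‖ₑ ^ q) hgm).symm
    _ = ∫⁻ t in Set.Ioc (0 : ℝ) 1, ∫⁻ x, ‖g x‖ₑ ^ q ∂μ := by
        refine lintegral_congr fun t ↦ ?_
        exact lintegral_add_right_eq_self (μ := μ) (fun x ↦ ‖g x‖ₑ ^ q) (t • z)
    _ = ∫⁻ x, ‖g x‖ₑ ^ q ∂μ := by simp

/-! ### Geometry: the interior cone condition. -/

/-- A set with Lipschitz boundary satisfies a uniform interior cone condition near every point of
its closure. -/
theorem HasLipschitzBoundary.exists_cone {d : ℕ} {Ω : Set (EuclideanSpace ℝ (Fin d))}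
    (hΩ : IsOpen Ω) (hLip : HasLipschitzBoundary Ω) {x₀ : EuclideanSpace ℝ (Fin d)}
    (hx₀ : x₀ ∈ closure Ω) :
    ∃ r > 0, ∀ δ > 0, ∃ (w : EuclideanSpace ℝ (Fin d)) (s : ℝ), 0 < s ∧ ‖w‖ + s ≤ δ ∧
      ∀ x ∈ Ω ∩ Metric.ball x₀ r, ∀ z ∈ Metric.ball w s, ∀ t ∈ Set.Icc (0 : ℝ) 1,
        x + t • z ∈ Ω := by
  by_cases hx : x₀ ∈ Ω
  · obtain ⟨r, hr, hrΩ⟩ := Metric.isOpen_iff.mp hΩ x₀ hx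
    refine ⟨r / 2, by positivity, fun δ hδ ↦ ⟨0, min δ (r / 2), by positivity, by simp, ?_⟩⟩
    rintro x ⟨-, hxr⟩ z hz t ⟨ht0, ht1⟩
    apply hrΩ
    rw [mem_ball_iff_norm] at hxr hz ⊢
    have h1 : ‖t • z‖ ≤ ‖z‖ := by
      rw [norm_smul, Real.norm_of_nonneg ht0]
      exact mul_le_of_le_one_left (norm_nonneg _) ht1
    have h2 : ‖z‖ < r / 2 := by
      simpa using hz.trans_le (min_le_right _ _)
    calc ‖x + t • z - x₀‖ = ‖(x - x₀) + t • z‖ := by congr 1; abel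
      _ ≤ ‖x - x₀‖ + ‖t • z‖ := norm_add_le _ _
      _ < r := by linarith
  · obtain ⟨ν, f, L, r, hν, hf, hr, H⟩ := hLip x₀ (by rw [hΩ.frontier_eq]; exact ⟨hx₀, hx⟩)
    refine ⟨r / 2, by positivity, fun δ hδ ↦ ?_⟩
    -- With `s = η / (L + 1) ≤ η`, the bound `δ / 2` gives `‖w‖ + s ≤ δ`, and `r / 4` gives `‖z‖ < r
    -- / 2`, which keeps `x + t z` in the chart.
    set η : ℝ := min (δ / 2) (r / 4) with hη
    have hη0 : 0 < η := by positivity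
    have hη1 : η ≤ δ / 2 := min_le_left _ _
    have hη2 : η ≤ r / 4 := min_le_right _ _
    have hL : (0 : ℝ) ≤ L := L.2
    have hs : η / (L + 1) ≤ η := div_le_self hη0.le (by linarith)
    have hwn : ‖η • ν‖ = η := by rw [norm_smul, hν, mul_one, Real.norm_of_nonneg hη0.le]
    refine ⟨η • ν, η / (L + 1), by positivity, by rw [hwn]; linarith, ?_⟩
    rintro x ⟨hxΩ, hxr⟩ z hz t ⟨ht0, ht1⟩
    rw [mem_ball_iff_norm] at hxr hz
    set e : EuclideanSpace ℝ (Fin d) := z - η • ν with he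
    have hze : z = η • ν + e := by rw [he]; abel
    have hzn : ‖z‖ < r / 2 := by
      rw [hze]
      refine (norm_add_le _ _).trans_lt ?_
      rw [hwn]
      linarith
    have htz : ‖t • z‖ ≤ ‖z‖ := by
      rw [norm_smul, Real.norm_of_nonneg ht0]
      exact mul_le_of_le_one_left (norm_nonneg _) ht1
    have hb : x + t • z ∈ Metric.ball x₀ r := by
      rw [mem_ball_iff_norm]
      calc ‖x + t • z - x₀‖ = ‖(x - x₀) + t • z‖ := by congr 1; abel
        _ ≤ ‖x - x₀‖ + ‖t • z‖ := norm_add_le _ _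
        _ < r := by linarith
    have hx1 := (H x (by rw [mem_ball_iff_norm]; linarith)).mp hxΩ
    refine (H _ hb).mpr ?_
    set P := (ℝ ∙ ν)ᗮ.orthogonalProjectionOnto with hP
    have hPν : P ν = 0 := by
      rw [hP, Submodule.orthogonalProjectionOnto_eq_zero_iff, Submodule.orthogonal_orthogonal]
      exact Submodule.mem_span_singleton_self ν
    have hPz : P (x + t • z) = P x + t • P e := by
      rw [hze]; simp [hPν]
    have hPe : ‖P e‖ ≤ η / (L + 1) :=
      (Submodule.norm_orthogonalProjectionOnto_apply_le _ _).trans hz.le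
    have h1 : f (P (x + t • z)) ≤ f (P x) + L * (t * (η / (L + 1))) := by
      have := hf.dist_le_mul (P (x + t • z)) (P x)
      rw [hPz, dist_eq_norm, dist_eq_norm, add_sub_cancel_left, norm_smul,
        Real.norm_of_nonneg ht0, ← hPz] at this
      have h3 := (le_abs_self _).trans this
      have h4 : L * (t * ‖P e‖) ≤ L * (t * (η / (L + 1))) := by gcongr
      linarith
    have h2 : inner ℝ ν (x + t • z) = inner ℝ ν x + t * (η + inner ℝ ν e) := by
      rw [hze, inner_add_right, inner_smul_right, inner_add_right, inner_smul_right,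
        real_inner_self_eq_norm_sq, hν]
      ring
    have h3 : -(η / (L + 1)) ≤ inner ℝ ν e := by
      have := abs_real_inner_le_norm ν e
      rw [hν, one_mul] at this
      have := (abs_le.mp (this.trans hz.le)).1
      exact this
    -- The choice of `s` balances the two effects: the graph rises by at most `L t s`, and the
    -- height over it rises by at least `t (η - s)`, the same number. Strictness is inherited from
    -- `x ∈ Ω`.
    have h4 : L * (t * (η / (L + 1))) = t * (η - η / (L + 1)) := by
      field_simp
      ring
    rw [h2]
    have h5 : t * (η - η / (L + 1)) ≤ t * (η + inner ℝ ν e) := by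
      gcongr
      linarith
    linarith

theorem lintegral_rpow_enorm_coe_eq {α X : Type*} {mα : MeasurableSpace α} [NormedAddCommGroup X]
    {μ : Measure α} {p : ℝ≥0∞} [Fact (1 ≤ p)] (hp : p ≠ ∞) (u : Lp X p μ) :
    ∫⁻ x, ‖u x‖ₑ ^ p.toReal ∂μ = ‖u‖ₑ ^ p.toReal := by
  have h0 : p ≠ 0 := (zero_lt_one.trans_le Fact.out).ne'
  rw [Lp.enorm_def, eLpNorm_eq_lintegral_rpow_enorm_toReal h0 hp, ← ENNReal.rpow_mul,
    one_div_mul_cancel (ENNReal.toReal_pos h0 hp).ne', ENNReal.rpow_one]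

/-! ### The translation estimate on `Ω`. -/

section Sobolev

variable {d : ℕ} {Ω : Opens (EuclideanSpace ℝ (Fin d))} {p : ℝ≥0∞}
  {X : Type*} [NormedAddCommGroup X] [NormedSpace ℝ X]

/-- A test function on `Ω` obtained by translating a function supported in `U`. -/
def translateTestFunction {U : Set (EuclideanSpace ℝ (Fin d))} (a : EuclideanSpace ℝ (Fin d))
    (hUΩ : ∀ x ∈ U, x + a ∈ Ω) (φ : EuclideanSpace ℝ (Fin d) → ℝ)
    (hφ : ContDiff ℝ (↑(⊤ : ℕ∞)) φ) (hφc : HasCompactSupport φ) (hφU : tsupport φ ⊆ U) :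
    𝓓(Ω, ℝ) where
  toFun y := φ (y - a)
  contDiff' := hφ.comp (contDiff_id.sub contDiff_const)
  hasCompactSupport' := hφc.comp_homeomorph (Homeomorph.subRight a)
  tsupport_subset' := by
    intro y hy
    have h : y - a ∈ tsupport φ := by
      have := tsupport_comp_subset_preimage φ (f := fun y ↦ y - a) (by fun_prop) hy
      exact this
    simpa using hUΩ _ (hφU h)

variable [hp1 : Fact (1 ≤ p)]

theorem HasDistribDeriv.direction {u : BochnerLp Ω p X}
    {D : Fin d → BochnerLp Ω p X} (h : ∀ j, HasDistribDeriv Ω j u (D j)) (φ : 𝓓(Ω, ℝ))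
    (z : EuclideanSpace ℝ (Fin d)) :
    ∫ x in Ω, fderiv ℝ φ x z • u x = - ∫ x in Ω, φ x • (∑ j, z j • D j : BochnerLp Ω p X) x := by
  have e1 : ∀ x, fderiv ℝ φ x z • u x = ∑ j, z j • (partialDeriv j φ x • u x) := by
    intro x
    have hz : z = ∑ j, z j • EuclideanSpace.single j (1 : ℝ) := by
      simpa using ((EuclideanSpace.basisFun (Fin d) ℝ).sum_repr z).symm
    conv_lhs => rw [hz]
    simp only [map_sum, map_smul, Finset.sum_smul, smul_smul, smul_eq_mul, partialDeriv]
  have e2 : ∀ᵐ x ∂(volume.restrict (Ω : Set (EuclideanSpace ℝ (Fin d)))),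
      φ x • (∑ j, z j • D j : BochnerLp Ω p X) x = ∑ j, z j • (φ x • D j x) := by
    have h1 : ∀ᵐ x ∂(volume.restrict (Ω : Set (EuclideanSpace ℝ (Fin d)))),
        ∀ j, (z j • D j : BochnerLp Ω p X) x = z j • D j x :=
      ae_all_iff.mpr fun j ↦ Lp.coeFn_smul _ _
    filter_upwards [h1, Lp.coeFn_finsetSum Finset.univ fun j ↦ z j • D j] with x hx hx'
    rw [hx', Finset.sum_apply, Finset.smul_sum]
    refine Finset.sum_congr rfl fun j _ ↦ ?_
    rw [hx, smul_comm]
  simp_rw [e1]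
  have i1 : ∀ j ∈ Finset.univ, Integrable (fun x ↦ z j • (partialDeriv j φ x • u x))
      (volume.restrict (Ω : Set (EuclideanSpace ℝ (Fin d)))) :=
    fun j _ ↦ (integrable_partialDeriv_smul hp1.out j φ u).smul (z j)
  have i2 : ∀ j ∈ Finset.univ, Integrable (fun x ↦ z j • (φ x • D j x))
      (volume.restrict (Ω : Set (EuclideanSpace ℝ (Fin d)))) :=
    fun j _ ↦ (integrable_testFunction_smul hp1.out φ (D j)).smul (z j)
  rw [integral_congr_ae e2, integral_finsetSum _ i1, integral_finsetSum _ i2,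
    ← Finset.sum_neg_distrib]
  refine Finset.sum_congr rfl fun j _ ↦ ?_
  rw [integral_smul, integral_smul, h j φ, smul_neg]

variable [CompleteSpace X]

/-- The translation estimate in the Sobolev space `W^{1,p}(Ω, X)`. -/
theorem lintegral_sub_translate_le
    (hΩ : Bornology.IsBounded (Ω : Set (EuclideanSpace ℝ (Fin d)))) (hp : p ≠ ∞)
    (u : sobolevSubmodule Ω p X) {U : Set (EuclideanSpace ℝ (Fin d))} (hU : IsOpen U)
    {z : EuclideanSpace ℝ (Fin d)} (hz : ∀ x ∈ U, ∀ t ∈ Set.Icc (0 : ℝ) 1, x + t • z ∈ Ω) :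
    ∫⁻ x in U, ‖(u : BochnerLp Ω p X) (x + z) - (u : BochnerLp Ω p X) x‖ₑ ^ p.toReal ≤
      ENNReal.ofReal (‖z‖ * sobolevNorm u) ^ p.toReal := by
  have hfin : IsFiniteMeasure (volume.restrict (Ω : Set (EuclideanSpace ℝ (Fin d)))) :=
    ⟨by simpa using hΩ.measure_lt_top⟩
  have hΩm := Ω.isOpen.measurableSet
  have hq : 1 ≤ p.toReal := by
    rw [← ENNReal.toReal_one]
    exact ENNReal.toReal_mono hp hp1.out
  -- Functions are extended by zero. The extension may have no weak derivative across the boundary,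
  -- but only test functions supported in `U + t z ⊆ Ω` are used.
  have hint : ∀ v : BochnerLp Ω p X,
      Integrable ((Ω : Set (EuclideanSpace ℝ (Fin d))).indicator v) := fun v ↦
    (integrable_indicator_iff hΩm).mpr ((Lp.memLp v).integrable hp1.out)
  set G : BochnerLp Ω p X := ∑ j, z j • distribDeriv j u with hG
  have hGn : ‖G‖ ≤ ‖z‖ * sobolevNorm u := by
    calc ‖G‖ ≤ ∑ j, ‖z j • distribDeriv j u‖ := norm_sum_le _ _
      _ ≤ ∑ j, ‖z‖ * ‖distribDeriv j u‖ := by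
          refine Finset.sum_le_sum fun j _ ↦ ?_
          rw [norm_smul]
          gcongr
          exact PiLp.norm_apply_le z j
      _ = ‖z‖ * ∑ j, ‖distribDeriv j u‖ := by rw [Finset.mul_sum]
      _ ≤ ‖z‖ * sobolevNorm u := by
          gcongr
          rw [sobolevNorm]
          linarith [norm_nonneg (u : BochnerLp Ω p X)]
  have hmul : ∀ (a : EuclideanSpace ℝ (Fin d) → ℝ) (v : BochnerLp Ω p X),
      ∫ y, a y • (Ω : Set (EuclideanSpace ℝ (Fin d))).indicator v y = ∫ y in Ω, a y • v y := by
    intro a v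
    rw [← integral_indicator hΩm]
    simp_rw [Set.indicator_smul]
  have key := lintegral_sub_translate_le_of_weak_deriv volume (hint u) (hint G) hU z ?_ hq
  · calc _ = ∫⁻ x in U, ‖(Ω : Set (EuclideanSpace ℝ (Fin d))).indicator
            (u : BochnerLp Ω p X) (x + z) - (Ω : Set (EuclideanSpace ℝ (Fin d))).indicator
            (u : BochnerLp Ω p X) x‖ₑ ^ p.toReal := by
          refine setLIntegral_congr_fun hU.measurableSet fun x hx ↦ ?_
          have h0 := hz x hx 0 (by simp)
          have h1 := hz x hx 1 (by simp)
          rw [zero_smul, add_zero] at h0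
          rw [one_smul] at h1
          simp only [Set.indicator_of_mem (show x ∈ (Ω : Set _) from h0),
            Set.indicator_of_mem (show x + z ∈ (Ω : Set _) from h1)]
      _ ≤ _ := key
      _ = ∫⁻ x in Ω, ‖G x‖ₑ ^ p.toReal := by
          rw [← lintegral_indicator hΩm]
          refine lintegral_congr fun x ↦ ?_
          by_cases hx : x ∈ (Ω : Set (EuclideanSpace ℝ (Fin d)))
          · simp [hx]
          · simp [hx, (zero_lt_one.trans_le hq)]
      _ = ‖G‖ₑ ^ p.toReal := lintegral_rpow_enorm_coe_eq hp G
      _ ≤ _ := by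
          rw [← ofReal_norm]
          gcongr
  · intro t ht φ hφ hφc hφU
    have h := HasDistribDeriv.direction (fun j ↦ hasDistribDeriv_distribDeriv j u)
      (translateTestFunction (t • z) (fun x hx ↦ hz x hx t ht) φ hφ hφc hφU) z
    have hf : ∀ y, fderiv ℝ (translateTestFunction (Ω := Ω) (t • z)
        (fun x hx ↦ hz x hx t ht) φ hφ hφc hφU) y z = fderiv ℝ φ (y - t • z) z := by
      intro y
      exact DFunLike.congr_fun (fderiv_comp_sub (𝕜 := ℝ) (f := φ) (t • z)) z
    simp_rw [hf] at h
    rw [hmul, hmul]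
    exact h

end Sobolev

/-! ### Approximation by local averages. -/

/-- The constant `a` can be moved inside the average, after which Jensen's inequality applies. -/
theorem rpow_enorm_sub_setAverage_le {α X : Type*} {mα : MeasurableSpace α} [NormedAddCommGroup X]
    [NormedSpace ℝ X] [CompleteSpace X] {μ : Measure α} {u : α → X} {B : Set α} (hB0 : μ B ≠ 0)
    (hB : μ B ≠ ∞) (hu : IntegrableOn u B μ) (a : X) {q : ℝ} (hq : 1 ≤ q) :
    ‖a - ⨍ y in B, u y ∂μ‖ₑ ^ q ≤ (μ B)⁻¹ * ∫⁻ y in B, ‖u y - a‖ₑ ^ q ∂μ := by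
  have : IsProbabilityMeasure ((μ B)⁻¹ • μ.restrict B) :=
    ⟨by simp [ENNReal.inv_mul_cancel hB0 hB]⟩
  have hi : Integrable u ((μ B)⁻¹ • μ.restrict B) :=
    Integrable.smul_measure hu (ENNReal.inv_ne_top.mpr hB0)
  have e : a - ⨍ y in B, u y ∂μ = - ∫ y, (u y - a) ∂((μ B)⁻¹ • μ.restrict B) := by
    rw [integral_sub hi (integrable_const a), average, Measure.restrict_apply_univ]
    simp
  rw [e, enorm_neg]
  refine (rpow_enorm_integral_le (hi.1.sub aestronglyMeasurable_const) hq).trans_eq ?_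
  rw [lintegral_smul_measure, smul_eq_mul]
  rfl

/-- Replacing a function by its averages over balls in the vicinity is controlled by its
translations. -/
theorem lintegral_sub_average_le {E : Type*} [NormedAddCommGroup E]
    [NormedSpace ℝ E] [MeasurableSpace E] [BorelSpace E] [FiniteDimensional ℝ E] (μ : Measure E)
    [μ.IsAddHaarMeasure] {X : Type*} [NormedAddCommGroup X] [NormedSpace ℝ X] [CompleteSpace X]
    {u : E → X} (hum : StronglyMeasurable u) {Ω A : Set E} (hu : IntegrableOn u Ω μ)
    (hA : MeasurableSet A) {π : E → E} {w : E} {s : ℝ} (hs : 0 < s)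
    (hπ : ∀ x ∈ A, dist (π x) x < s / 2) (hAΩ : ∀ x ∈ A, ∀ z ∈ Metric.ball w s, x + z ∈ Ω)
    {q : ℝ} (hq : 1 ≤ q) {c : ℝ≥0∞}
    (hc : ∀ z ∈ Metric.ball w s, ∫⁻ x in A, ‖u (x + z) - u x‖ₑ ^ q ∂μ ≤ c) :
    ∫⁻ x in A, ‖u x - ⨍ y in Metric.ball (π x + w) (s / 2), u y ∂(μ.restrict Ω)‖ₑ ^ q ∂μ ≤
      2 ^ Module.finrank ℝ E * c := by
  set b : ℝ≥0∞ := μ (Metric.ball (0 : E) (s / 2)) with hb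
  have hb0 : b ≠ 0 := (Metric.measure_ball_pos μ _ (by positivity)).ne'
  have hbt : b ≠ ∞ := measure_ball_lt_top.ne
  have hpt : ∀ x ∈ A,
      ‖u x - ⨍ y in Metric.ball (π x + w) (s / 2), u y ∂(μ.restrict Ω)‖ₑ ^ q ≤
        b⁻¹ * ∫⁻ z in Metric.ball w s, ‖u (x + z) - u x‖ₑ ^ q ∂μ := by
    intro x hx
    have hsub : Metric.ball (π x + w) (s / 2) ⊆ Metric.ball (x + w) s := by
      refine Metric.ball_subset_ball' ?_
      rw [dist_add_right]
      linarith [hπ x hx]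
    have hsubΩ : Metric.ball (x + w) s ⊆ Ω := by
      intro y hy
      have := hAΩ x hx (y - x) (by
        rw [mem_ball_iff_norm] at hy ⊢
        rwa [sub_sub])
      simpa using this
    rw [Measure.restrict_restrict measurableSet_ball,
      Set.inter_eq_left.mpr (hsub.trans hsubΩ)]
    have hbx : μ (Metric.ball (π x + w) (s / 2)) = b := Measure.addHaar_ball_center μ _ _
    refine (rpow_enorm_sub_setAverage_le (by rwa [hbx]) (by rwa [hbx])
      (hu.mono_set (hsub.trans hsubΩ)) (u x) hq).trans ?_
    rw [hbx]
    refine mul_le_mul_right ?_ _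
    calc _ ≤ ∫⁻ y in Metric.ball (x + w) s, ‖u y - u x‖ₑ ^ q ∂μ := lintegral_mono_set hsub
      _ = ∫⁻ z in Metric.ball w s, ‖u (x + z) - u x‖ₑ ^ q ∂μ := by
        have hpre : (fun z ↦ x + z) ⁻¹' Metric.ball (x + w) s = Metric.ball w s := by
          ext z; simp [dist_eq_norm]
        have := (measurePreserving_add_left μ x).setLIntegral_comp_preimage_emb
          (MeasurableEquiv.addLeft x).measurableEmbedding
          (fun y ↦ ‖u y - u x‖ₑ ^ q) (Metric.ball (x + w) s)
        rw [hpre] at this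
        exact this.symm
  calc _ ≤ ∫⁻ x in A, b⁻¹ * (∫⁻ z in Metric.ball w s, ‖u (x + z) - u x‖ₑ ^ q ∂μ) ∂μ :=
        setLIntegral_mono' hA hpt
    _ = b⁻¹ * ∫⁻ x in A, (∫⁻ z in Metric.ball w s, ‖u (x + z) - u x‖ₑ ^ q ∂μ) ∂μ :=
        lintegral_const_mul' _ _ (ENNReal.inv_ne_top.mpr hb0)
    _ = b⁻¹ * ∫⁻ z in Metric.ball w s, (∫⁻ x in A, ‖u (x + z) - u x‖ₑ ^ q ∂μ) ∂μ := by
        -- After the swap, the translation bound `hc` applies for each fixed `z`.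
        rw [lintegral_lintegral_swap]
        refine StronglyMeasurable.aestronglyMeasurable ?_ |>.enorm.pow_const q
        exact (hum.comp_measurable (measurable_fst.add measurable_snd)).sub
          (hum.comp_measurable measurable_fst)
    _ ≤ b⁻¹ * ∫⁻ z in Metric.ball w s, c ∂μ := by
        refine mul_le_mul_right ?_ _
        exact setLIntegral_mono' measurableSet_ball hc
    _ = b⁻¹ * (c * μ (Metric.ball w s)) := by rw [setLIntegral_const]
    _ = 2 ^ Module.finrank ℝ E * c := by
        -- The dimensional factor is the volume ratio of balls of radii `s` and `s / 2`.
        have h2 : μ (Metric.ball w s) = 2 ^ Module.finrank ℝ E * b := by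
          have := Measure.addHaar_ball_mul_of_pos μ w (zero_lt_two (α := ℝ)) (s / 2)
          rw [mul_div_cancel₀ _ two_ne_zero, ENNReal.ofReal_pow zero_le_two] at this
          simpa using this
        rw [h2, show b⁻¹ * (c * (2 ^ Module.finrank ℝ E * b)) =
          (b⁻¹ * b) * (2 ^ Module.finrank ℝ E * c) by ring, ENNReal.inv_mul_cancel hb0 hbt, one_mul]

/-! ### Tools: finite nets, total boundedness, and `L^p` in `L^1`. -/

theorem exists_simpleFunc_dist_lt {E : Type*} [PseudoMetricSpace E] [MeasurableSpace E]
    [OpensMeasurableSpace E] [Nonempty E] {A : Set E} (hA : TotallyBounded A) {ε : ℝ}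
    (hε : 0 < ε) : ∃ π : SimpleFunc E E, ∀ x ∈ A, dist (π x) x < ε := by
  obtain ⟨t, ht, hAt⟩ := Metric.totallyBounded_iff.mp hA ε hε
  rcases t.eq_empty_or_nonempty with rfl | hne
  · exact ⟨SimpleFunc.const E (Classical.arbitrary E), fun x hx ↦ by simpa using hAt hx⟩
  obtain ⟨e, rfl⟩ := ht.countable.exists_eq_range hne
  choose! k hk using fun y (hy : y ∈ Set.range e) ↦ hy
  obtain ⟨N, hN⟩ := (ht.image k).bddAbove
  refine ⟨SimpleFunc.nearestPt e N, fun x hx ↦ ?_⟩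
  obtain ⟨y, hy, hxy⟩ := Set.mem_iUnion₂.mp (hAt hx)
  have h := SimpleFunc.edist_nearestPt_le e x (hN (Set.mem_image_of_mem k hy))
  rw [hk y hy] at h
  rw [← edist_lt_ofReal]
  refine h.trans_lt ?_
  rwa [edist_lt_ofReal, dist_comm]

theorem continuous_indicatorConstLp_const {α X : Type*} {mα : MeasurableSpace α}
    [NormedAddCommGroup X] {μ : Measure α} {p : ℝ≥0∞} [Fact (1 ≤ p)] {s : Set α}
    (hs : MeasurableSet s) (hμs : μ s ≠ ∞) :
    Continuous fun c : X ↦ indicatorConstLp p hs hμs c := by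
  let f : X →+ Lp X p μ :=
    { toFun := fun c ↦ indicatorConstLp p hs hμs c
      map_zero' := by
        simpa using (indicatorConstLp_sub (p := p) (hs := hs) (hμs := hμs) (c := (0 : X))
          (c' := 0)).symm
      map_add' := fun _ _ ↦ indicatorConstLp_add.symm }
  exact AddMonoidHomClass.continuous_of_bound f (μ.real s ^ (1 / p.toReal)) fun c ↦ by
    rw [mul_comm]
    exact norm_indicatorConstLp_le (hs := hs) (hμs := hμs)

theorem totallyBounded_of_forall_exists_isCompact {α : Type*} [PseudoMetricSpace α] {s : Set α}
    (h : ∀ ε > 0, ∃ K : Set α, IsCompact K ∧ ∀ x ∈ s, ∃ k ∈ K, dist x k ≤ ε) :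
    TotallyBounded s := by
  rw [Metric.totallyBounded_iff]
  intro ε hε
  obtain ⟨K, hK, hsK⟩ := h (ε / 2) (by positivity)
  obtain ⟨t, ht, hKt⟩ := Metric.totallyBounded_iff.mp hK.totallyBounded (ε / 2) (by positivity)
  refine ⟨t, ht, fun x hx ↦ ?_⟩
  obtain ⟨k, hk, hxk⟩ := hsK x hx
  obtain ⟨y, hy, hky⟩ := Set.mem_iUnion₂.mp (hKt hk)
  refine Set.mem_iUnion₂.mpr ⟨y, hy, ?_⟩
  rw [Metric.mem_ball] at hky ⊢
  linarith [dist_triangle x k y]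

/-- Hölder's inequality on a finite measure space; the constant is the total mass to the power `1 -
1 / p`. -/
theorem exists_forall_integral_norm_le {α Y : Type*} {mα : MeasurableSpace α}
    [NormedAddCommGroup Y] (μ : Measure α) [IsFiniteMeasure μ] (p : ℝ≥0∞) [Fact (1 ≤ p)] :
    ∃ C : ℝ, 0 ≤ C ∧ ∀ v : Lp Y p μ, ∫ x, ‖v x‖ ∂μ ≤ C * ‖v‖ := by
  set a : ℝ≥0∞ := μ Set.univ ^ (1 / (1 : ℝ≥0∞).toReal - 1 / p.toReal) with ha
  have h1 : (1 : ℝ≥0∞) ≤ p := Fact.out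
  have hat : a ≠ ∞ := by
    refine ENNReal.rpow_ne_top_of_nonneg ?_ (measure_ne_top _ _)
    rcases eq_or_ne p ∞ with rfl | hp
    · simp
    · have : 1 ≤ p.toReal := by simpa using ENNReal.toReal_mono hp h1
      rw [ENNReal.toReal_one, sub_nonneg]
      gcongr
  refine ⟨a.toReal, ENNReal.toReal_nonneg, fun v ↦ ?_⟩
  have h := eLpNorm_le_eLpNorm_mul_rpow_measure_univ (μ := μ) h1 (Lp.aestronglyMeasurable v)
  rw [← ha, eLpNorm_one_eq_lintegral_enorm] at h
  rw [integral_norm_eq_lintegral_enorm (Lp.aestronglyMeasurable v), Lp.norm_def, mul_comm,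
    ← ENNReal.toReal_mul]
  exact ENNReal.toReal_mono (ENNReal.mul_ne_top (Lp.eLpNorm_ne_top v) hat) h

/-! ### Compactness on one piece of `Ω`. -/

section Sobolev

variable {d : ℕ} {Ω : Opens (EuclideanSpace ℝ (Fin d))} {p : ℝ≥0∞} [hp1 : Fact (1 ≤ p)]
  {X Y : Type*} [NormedAddCommGroup X] [NormedSpace ℝ X] [CompleteSpace X]
  [NormedAddCommGroup Y] [NormedSpace ℝ Y] [CompleteSpace Y]
  {ι : Y →L[ℝ] X} {hι : Function.Injective ι}

namespace SobolevInterLp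

/-- The averages over a fixed set of the functions in the unit ball of
`W^{1,p}(Ω, X) ∩ L^p(Ω, Y)` lie in a compact subset of `X`. -/
theorem exists_isCompact_setAverage_mem
    (hΩ : Bornology.IsBounded (Ω : Set (EuclideanSpace ℝ (Fin d)))) (hcomp : IsCompactOperator ι)
    (B : Set (EuclideanSpace ℝ (Fin d))) :
    ∃ K : Set X, IsCompact K ∧ ∀ u : SobolevInterLp Ω p ι hι, ‖u‖ ≤ 1 →
      ⨍ y in B, toLp u y ∂(volume.restrict (Ω : Set (EuclideanSpace ℝ (Fin d)))) ∈ K := by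
  set ν := volume.restrict (Ω : Set (EuclideanSpace ℝ (Fin d))) with hν
  have hfin : IsFiniteMeasure ν := ⟨by simpa [hν] using hΩ.measure_lt_top⟩
  obtain ⟨C, hC0, hC⟩ := exists_forall_integral_norm_le (Y := Y) ν p
  -- The average of `toLp u` is `ι` of the average of `toLpY u`. If `B` is null, the inverse is `0`
  -- and so is the average, so no condition on `B` is needed.
  refine ⟨_, hcomp.isCompact_closure_image_closedBall (f := ι.toLinearMap)
    ((ν.real B)⁻¹ * C), fun u hu ↦ subset_closure ⟨(ν.real B)⁻¹ • ∫ y in B, toLpY u y ∂ν, ?_, ?_⟩⟩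
  · have hi : Integrable (fun x ↦ ‖toLpY u x‖) ν := ((Lp.memLp (toLpY u)).integrable hp1.out).norm
    rw [mem_closedBall_zero_iff, norm_smul, Real.norm_of_nonneg (by positivity)]
    gcongr
    calc ‖∫ y in B, toLpY u y ∂ν‖ ≤ ∫ y in B, ‖toLpY u y‖ ∂ν := norm_integral_le_integral_norm _
      _ ≤ ∫ y, ‖toLpY u y‖ ∂ν :=
        setIntegral_le_integral hi (Filter.Eventually.of_forall fun _ ↦ norm_nonneg _)
      _ ≤ C * ‖toLpY u‖ := hC _
      _ ≤ C := by
        refine mul_le_of_le_one_right hC0 (le_trans ?_ hu)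
        rw [norm_def]
        have := Finset.sum_nonneg fun j (_ : j ∈ Finset.univ) ↦
          norm_nonneg (distribDeriv j (toSobolev u))
        linarith [norm_nonneg (toLp u)]
  · have hae : ∀ᵐ x ∂ν.restrict B, toLp u x = ι (toLpY u x) := by
      refine ae_restrict_of_ae ?_
      rw [← compLpL_toLpY u]
      exact ι.coeFn_compLpL _
    rw [setAverage_eq, integral_congr_ae hae,
      ι.integral_comp_comm ((Lp.memLp (toLpY u)).integrable hp1.out).integrableOn]
    exact map_smul ι _ _

/-- Where `Ω` satisfies the uniform cone condition, the unit ball of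
`W^{1,p}(Ω, X) ∩ L^p(Ω, Y)` is relatively compact in `L^p(Ω, X)`. -/
theorem exists_isCompact_indicator_mem
    (hΩ : Bornology.IsBounded (Ω : Set (EuclideanSpace ℝ (Fin d)))) (hcomp : IsCompactOperator ι)
    (hp : p ≠ ∞) {U : Set (EuclideanSpace ℝ (Fin d))} (hU : IsOpen U) (hUΩ : U ⊆ Ω)
    (hcone : ∀ δ > 0, ∃ (w : EuclideanSpace ℝ (Fin d)) (s : ℝ), 0 < s ∧ ‖w‖ + s ≤ δ ∧
      ∀ x ∈ U, ∀ z ∈ Metric.ball w s, ∀ t ∈ Set.Icc (0 : ℝ) 1, x + t • z ∈ Ω)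
    {E : Set (EuclideanSpace ℝ (Fin d))} (hE : MeasurableSet E) (hEU : E ⊆ U) :
    ∃ K : Set (BochnerLp Ω p X), IsCompact K ∧ ∀ u : SobolevInterLp Ω p ι hι, ‖u‖ ≤ 1 →
      ∃ k ∈ K, k =ᵐ[volume.restrict (Ω : Set (EuclideanSpace ℝ (Fin d)))]
        E.indicator (toLp u) := by
  set ν := volume.restrict (Ω : Set (EuclideanSpace ℝ (Fin d))) with hν
  have hfin : IsFiniteMeasure ν := ⟨by simpa [hν] using hΩ.measure_lt_top⟩
  have hq : 1 ≤ p.toReal := by simpa using ENNReal.toReal_mono hp hp1.out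
  have hp0 : p ≠ 0 := (zero_lt_one.trans_le hp1.out).ne'
  let T : SobolevInterLp Ω p ι hι → BochnerLp Ω p X :=
    fun u ↦ ((Lp.memLp (toLp u)).indicator hE).toLp _
  have hT : ∀ u, T u =ᵐ[ν] E.indicator (toLp u) := fun u ↦ MemLp.coeFn_toLp _
  suffices hTB : TotallyBounded (T '' {u | ‖u‖ ≤ 1}) from
    ⟨_, hTB.closure.isCompact_of_isClosed isClosed_closure, fun u hu ↦
      ⟨T u, subset_closure ⟨u, hu, rfl⟩, hT u⟩⟩
  refine totallyBounded_of_forall_exists_isCompact fun ε hε ↦ ?_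
  -- Dividing by `2 ^ d` absorbs the volume ratio, since `2 ^ d ≤ (2 ^ d) ^ p`.
  obtain ⟨w, s, hs, hws, hcs⟩ := hcone (ε / 2 ^ d) (by positivity)
  have hEb : TotallyBounded E :=
    (Metric.isCompact_of_isClosed_isBounded isClosed_closure
      (hΩ.subset (hEU.trans hUΩ)).closure).totallyBounded.subset subset_closure
  obtain ⟨π, hπ⟩ := exists_simpleFunc_dist_lt hEb (half_pos hs)
  let B : EuclideanSpace ℝ (Fin d) → Set (EuclideanSpace ℝ (Fin d)) :=
    fun y ↦ Metric.ball (y + w) (s / 2)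
  choose K hK hKu using fun y ↦
    exists_isCompact_setAverage_mem (p := p) (hι := hι) hΩ hcomp (B y)
  have hm : ∀ y, MeasurableSet (E ∩ π ⁻¹' {y}) := fun y ↦ hE.inter (π.measurableSet_fiber y)
  -- Step functions on the fibres of `π`, parametrised by their values. Only finitely many
  -- coordinates of `c` enter, so `Ψ` is continuous on the full product, where Tychonoff's theorem
  -- gives compactness.
  let Ψ : (EuclideanSpace ℝ (Fin d) → X) → BochnerLp Ω p X :=
    fun c ↦ ∑ y ∈ π.range, indicatorConstLp p (hm y) (measure_ne_top ν _) (c y)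
  have hΨ : Continuous Ψ := continuous_finsetSum _ fun y _ ↦
    (continuous_indicatorConstLp_const (hm y) (measure_ne_top ν _)).comp (continuous_apply y)
  have hΨc : ∀ c, Ψ c =ᵐ[ν] E.indicator fun x ↦ c (π x) := by
    intro c
    have h1 : ∀ᵐ x ∂ν, ∀ y ∈ π.range, indicatorConstLp p (hm y) (measure_ne_top ν _) (c y) x =
        (E ∩ π ⁻¹' {y}).indicator (fun _ ↦ c y) x :=
      (Finset.eventually_all _).mpr fun y _ ↦ indicatorConstLp_coeFn
    filter_upwards [h1, Lp.coeFn_finsetSum π.range fun y ↦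
      indicatorConstLp p (hm y) (measure_ne_top ν _) (c y)] with x hx hx'
    rw [hx', Finset.sum_apply, Finset.sum_congr rfl hx, Finset.sum_eq_single (π x)]
    · by_cases hxE : x ∈ E <;> simp [hxE]
    · intro y _ hy
      simp [hy.symm]
    · intro h
      exact absurd (π.mem_range_self x) h
  refine ⟨Ψ '' Set.univ.pi K, (isCompact_univ_pi hK).image hΨ, ?_⟩
  rintro _ ⟨u, hu, rfl⟩
  refine ⟨_, ⟨fun y ↦ ⨍ x in B y, toLp u x ∂ν, fun y _ ↦ hKu y u hu, rfl⟩, ?_⟩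
  have hsob : sobolevNorm (toSobolev u) ≤ 1 :=
    le_trans (le_add_of_nonneg_right (norm_nonneg (toLpY u))) hu
  have hav := lintegral_sub_average_le volume (Lp.stronglyMeasurable (toLp u))
    (Ω := (Ω : Set (EuclideanSpace ℝ (Fin d)))) ((Lp.memLp (toLp u)).integrable hp1.out) hE hs hπ
    (fun x hx z hz ↦ by simpa using hcs x (hEU hx) z hz 1 (by simp)) hq
    (c := ENNReal.ofReal (ε / 2 ^ d) ^ p.toReal) (fun z hz ↦ by
      refine (lintegral_mono_set hEU).trans ((lintegral_sub_translate_le hΩ hp (toSobolev u) hU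
        fun x hx ↦ hcs x hx z hz).trans ?_)
      gcongr
      rw [mem_ball_iff_norm] at hz
      calc ‖z‖ * sobolevNorm (toSobolev u) ≤ ‖z‖ := mul_le_of_le_one_right (norm_nonneg _) hsob
        _ ≤ ‖w‖ + ‖z - w‖ := norm_le_insert' z w
        _ ≤ ε / 2 ^ d := by linarith)
  rw [dist_edist, Lp.edist_def, eLpNorm_eq_lintegral_rpow_enorm_toReal hp0 hp]
  refine ENNReal.toReal_le_of_le_ofReal hε.le ?_
  rw [one_div, ENNReal.rpow_inv_le_iff (zero_lt_one.trans_le hq)]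
  calc _ = ∫⁻ x in E, ‖toLp u x - ⨍ y in B (π x), toLp u y ∂ν‖ₑ ^ p.toReal := by
        rw [← Set.inter_eq_left.mpr (hEU.trans hUΩ), ← Measure.restrict_restrict hE,
          ← lintegral_indicator hE]
        refine lintegral_congr_ae ?_
        filter_upwards [hT u, hΨc fun y ↦ ⨍ x in B y, toLp u x ∂ν] with x hx hx'
        rw [Pi.sub_apply, hx, hx']
        by_cases hxE : x ∈ E
        · simp [hxE]
        · simp [hxE, zero_lt_one.trans_le hq]
    _ ≤ _ := hav
    _ ≤ (2 ^ d) ^ p.toReal * ENNReal.ofReal (ε / 2 ^ d) ^ p.toReal := by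
        rw [finrank_euclideanSpace_fin]
        gcongr
        exact ENNReal.le_rpow_self_of_one_le (one_le_pow₀ one_le_two) hq
    _ = ENNReal.ofReal ε ^ p.toReal := by
        rw [← ENNReal.mul_rpow_of_nonneg _ _ (zero_le_one.trans hq)]
        congr 1
        rw [show (2 : ℝ≥0∞) ^ d = ENNReal.ofReal (2 ^ d) by
            rw [ENNReal.ofReal_pow zero_le_two]; simp,
          ← ENNReal.ofReal_mul (by positivity), mul_div_cancel₀ _ (by positivity)]

end SobolevInterLp

end Sobolev

/-! ### Gluing the pieces. -/

/-- Multidimensional Aubin–Lions lemma. -/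
theorem mainTheorem10 {d : ℕ} (Ω : Opens (EuclideanSpace ℝ (Fin d)))
    (hΩ : Bornology.IsBounded (Ω : Set (EuclideanSpace ℝ (Fin d))))
    (hLip : HasLipschitzBoundary (Ω : Set (EuclideanSpace ℝ (Fin d))))
    {X Y : Type*} [NormedAddCommGroup X] [NormedSpace ℝ X] [CompleteSpace X]
    [NormedAddCommGroup Y] [NormedSpace ℝ Y] [CompleteSpace Y]
    (ι : Y →L[ℝ] X) (hι : Function.Injective ι) (hcomp : IsCompactOperator ι)
    (p : ℝ≥0∞) [Fact (1 ≤ p)] (hp : p ≠ ∞) :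
    IsCompactOperator (SobolevInterLp.embedding Ω p ι hι) := by
  set ν := volume.restrict (Ω : Set (EuclideanSpace ℝ (Fin d))) with hν
  -- Compactness is claimed for every measurable `E ⊆ S ∩ Ω` so that it survives unions: `E` splits
  -- into the disjoint parts `E ∩ S` and `E \ S`, and the two compact sets are added.
  have key : ∃ S, MeasurableSet S ∧ closure (Ω : Set (EuclideanSpace ℝ (Fin d))) ⊆ S ∧
      ∀ E ⊆ S ∩ Ω, MeasurableSet E → ∃ K : Set (BochnerLp Ω p X), IsCompact K ∧
        ∀ u : SobolevInterLp Ω p ι hι, ‖u‖ ≤ 1 →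
          ∃ k ∈ K, k =ᵐ[ν] E.indicator (SobolevInterLp.toLp u) := by
    have hc : IsCompact (closure (Ω : Set (EuclideanSpace ℝ (Fin d)))) :=
      Metric.isCompact_of_isClosed_isBounded isClosed_closure hΩ.closure
    refine hc.induction_on (p := fun A ↦ ∃ S, MeasurableSet S ∧ A ⊆ S ∧
      ∀ E ⊆ S ∩ Ω, MeasurableSet E → ∃ K : Set (BochnerLp Ω p X), IsCompact K ∧
        ∀ u : SobolevInterLp Ω p ι hι, ‖u‖ ≤ 1 →
          ∃ k ∈ K, k =ᵐ[ν] E.indicator (SobolevInterLp.toLp u)) ?_ ?_ ?_ ?_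
    · refine ⟨∅, .empty, subset_rfl, fun E hE _ ↦ ⟨{0}, isCompact_singleton, fun u _ ↦ ⟨0, rfl, ?_⟩⟩⟩
      have hE0 : E = ∅ := by simpa using hE
      rw [hE0, Set.indicator_empty]
      exact Lp.coeFn_zero X p ν
    · rintro s t hst ⟨S, hS, hsub, h⟩
      exact ⟨S, hS, hst.trans hsub, h⟩
    · rintro s t ⟨S, hS, hsub, h⟩ ⟨S', hS', hsub', h'⟩
      refine ⟨S ∪ S', hS.union hS', Set.union_subset_union hsub hsub', fun E hE hEm ↦ ?_⟩
      obtain ⟨K, hK, hKu⟩ := h (E ∩ S) (fun x hx ↦ ⟨hx.2, (hE hx.1).2⟩) (hEm.inter hS)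
      obtain ⟨K', hK', hKu'⟩ := h' (E \ S)
        (fun x hx ↦ ⟨(hE hx.1).1.resolve_left hx.2, (hE hx.1).2⟩) (hEm.diff hS)
      refine ⟨_, (hK.prod hK').image continuous_add, fun u hu ↦ ?_⟩
      obtain ⟨k, hk, hku⟩ := hKu u hu
      obtain ⟨k', hk', hku'⟩ := hKu' u hu
      refine ⟨k + k', ⟨(k, k'), ⟨hk, hk'⟩, rfl⟩, ?_⟩
      filter_upwards [Lp.coeFn_add k k', hku, hku'] with x hx hx1 hx2
      rw [hx, Pi.add_apply, hx1, hx2]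
      by_cases hxE : x ∈ E <;> by_cases hxS : x ∈ S <;> simp [hxE, hxS]
    · intro x hx
      obtain ⟨r, hr, hcone⟩ := hLip.exists_cone Ω.isOpen hx
      refine ⟨Metric.ball x r, mem_nhdsWithin_of_mem_nhds (Metric.ball_mem_nhds x hr),
        Metric.ball x r, measurableSet_ball, subset_rfl, fun E hE hEm ↦ ?_⟩
      exact SobolevInterLp.exists_isCompact_indicator_mem hΩ hcomp hp
        (Ω.isOpen.inter Metric.isOpen_ball) Set.inter_subset_left hcone hEm
        (hE.trans (Set.inter_comm _ _).subset)
  obtain ⟨S, -, hΩS, hS⟩ := key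
  obtain ⟨K, hK, hKu⟩ := hS Ω (Set.subset_inter (subset_closure.trans hΩS) subset_rfl)
    Ω.isOpen.measurableSet
  rw [isCompactOperator_iff_exists_mem_nhds_image_subset_compact]
  refine ⟨Metric.closedBall 0 1, Metric.closedBall_mem_nhds 0 one_pos, K, hK, ?_⟩
  rintro _ ⟨u, hu, rfl⟩
  obtain ⟨k, hk, hku⟩ := hKu u (mem_closedBall_zero_iff.mp hu)
  have : k = SobolevInterLp.embedding Ω p ι hι u := by
    refine Lp.ext ?_
    filter_upwards [hku, ae_restrict_mem Ω.isOpen.measurableSet] with x hx hxΩ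
    rw [hx, Set.indicator_of_mem hxΩ]
    rfl
  rwa [← this]
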